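/- Let $X$ be a (possibly large) category. The lax comma category $\mathrm{Cat}/\!/X$ has as objects the pairs $(W,a)$ with $W$ a small category and $a : W \to X$ a functor. A morphism $(W,a)\to(Y,b)$ is a pair $(f,\gamma)$ of a functor $f : W\to Y$ and a natural transformation $\gamma : a \Rightarrow b\circ f$; the composite of $(f,\gamma):(W,a)\to(Y,b)$ and $(g,\chi):(Y,b)\to(Z,c)$ is $(g\circ f,\ (\chi * \mathrm{id}_f)\cdot\gamma)$, and the identity of $(W,a)$ is $(\mathrm{id}_W,\mathrm{id}_a)$. Let $U : \mathrm{Cat}/\!/X \to \mathrm{Cat}$ be the forgetful functor to the category of small categories, $(W,a)\mapsto W$, $(f,\gamma)\mapsto f$. A morphism $q : e \to b$ of a category $C$ is of effective descent if $C$ has pullbacks along $q$ and the change-of-base functor $q^* : C/b \to C/e$ is monadic, that is, it has a left adjoint and the comparison functor to the category of Eilenberg–Moore algebras of the induced monad is an equivalence. Theorem. If $X$ has pullbacks and a strict initial object (an initial object $0$ such that every morphism with codomain $0$ is an isomorphism), then $U : \mathrm{Cat}/\!/X \to \mathrm{Cat}$ preserves effective descent morphisms: if $(f,\gamma)$ is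 of effective descent in $\mathrm{Cat}/\!/X$, then $f$ is of effective descent in $\mathrm{Cat}$. -/

import Mathlib

open CategoryTheory CategoryTheory.Limits

universe w v u

/-- Objects of the lax comma category `Cat // X`: pairs `(W, a)` of a small category `W`
and a functor `a : W ⥤ X` (where `X` may be large). -/
structure LaxComma (X : Type u) [Category.{v} X] : Type (max u v (w + 1)) where
  /-- the underlying small category -/
  base : Cat.{w, w}
  /-- the structure functor -/
  str : base ⥤ X

namespace LaxComma

variable {X : Type u} [Category.{v} X]

/-- Morphisms `(W, a) ⟶ (Y, b)` of `Cat // X`: pairs `(f, γ)` of a functor `f : W ⥤ Y`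
and a natural transformation `γ : a ⟶ f ⋙ b`. -/
structure Hom (A B : LaxComma.{w} X) : Type (max v w) where
  /-- the underlying functor -/
  fctr : A.base ⥤ B.base
  /-- the natural transformation -/
  cell : A.str ⟶ fctr ⋙ B.str

/-- The identity of `(W, a)` is `(𝟭 W, 𝟙 a)`; the composite of `(f, γ)` and `(g, χ)` is
`(f ⋙ g, (χ ∗ id_f) · γ)`, whose second part has components `γ_t ≫ χ_{f t}`. -/
instance : Category.{max v w} (LaxComma.{w} X) where
  Hom A B := Hom A B
  id A := { fctr := 𝟭 A.base, cell := 𝟙 A.str }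
  comp {_ _ C} p q :=
    { fctr := p.fctr ⋙ q.fctr
      cell := p.cell ≫ Functor.whiskerLeft p.fctr q.cell ≫
        (Functor.associator p.fctr q.fctr C.str).inv }
  id_comp p := congrArg (Hom.mk p.fctr) (by ext t; simp)
  comp_id p := congrArg (Hom.mk p.fctr) (by ext t; simp)
  assoc p q r := congrArg (Hom.mk (p.fctr ⋙ q.fctr ⋙ r.fctr)) (by ext t; simp)

/-- The forgetful functor `U : Cat // X ⥤ Cat`, `(W, a) ↦ W`, `(f, γ) ↦ f`. -/
def forget (X : Type u) [Category.{v} X] : LaxComma.{w} X ⥤ Cat.{w, w} where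
  obj A := A.base
  map p := p.fctr.toCatHom

end LaxComma

/-- A morphism `q : e ⟶ b` is of effective descent if pullbacks along `q` exist and the
change-of-base functor `q^* : Over b ⥤ Over e` is monadic. -/
def IsEffectiveDescent {C : Type u} [Category.{v} C] {e b : C} (q : e ⟶ b) : Prop :=
  ∃ _ : HasPullbacksAlong q, Nonempty (MonadicRightAdjoint (Over.pullback q))

/-! Pairing categories with the constant functor at `0` embeds `Cat / Y` fully faithfully in `(Cat
// X) / (Y, b)`, compatibly with change of base. By strictness its image consists of the
initial-valued objects. Monadicity of `q^*` then restricts to `f^*` by Beck's criterion, provided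
coequalizers formed upstairs stay in the image. This holds because `D` is initial-valued as soon as
`q^* D` is (`essImage_of_essImage_pullback`). -/

namespace CategoryTheory

/-- Split coequalizers transport along isomorphisms of parallel pairs. -/
def IsSplitCoequalizer.ofIso {C : Type*} [Category* C] {X Y X' Y' Z : C} {f g : X ⟶ Y}
    {f' g' : X' ⟶ Y'} {π : Y ⟶ Z} (t : IsSplitCoequalizer f g π) (i : X' ≅ X) (j : Y' ≅ Y)
    (hf : f' ≫ j.hom = i.hom ≫ f) (hg : g' ≫ j.hom = i.hom ≫ g) :
    IsSplitCoequalizer f' g' (j.hom ≫ π) where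
  rightSection := t.rightSection ≫ j.inv
  leftSection := j.hom ≫ t.leftSection ≫ i.inv
  condition := by rw [reassoc_of% hf, reassoc_of% hg, t.condition]
  leftSection_bottom := by
    have : i.inv ≫ g' = g ≫ j.inv := by rw [Iso.inv_comp_eq, ← reassoc_of% hg]; simp
    simp [this]
  leftSection_top := by
    have : i.inv ≫ f' = f ≫ j.inv := by rw [Iso.inv_comp_eq, ← reassoc_of% hf]; simp
    simp [this]

/-- Monadic functors reflect isomorphisms. -/
theorem reflectsIsomorphisms_of_monadicRightAdjoint {C D : Type*} [Category* C] [Category* D]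
    (R : D ⥤ C) [MonadicRightAdjoint R] : R.ReflectsIsomorphisms :=
  have : (Monad.comparison (monadicAdjunction R)).IsEquivalence := MonadicRightAdjoint.eqv
  reflectsIsomorphisms_of_iso (Monad.comparisonForget (monadicAdjunction R))

section

variable {C D C' D' : Type*} [Category.{v} C] [Category.{v} D] [Category.{w} C'] [Category.{w} D']
  {G : D ⥤ C} {G' : D' ⥤ C'} {Φ : D ⥤ D'} {Ψ : C ⥤ C'}

/-- `G`-split pairs are sent to `G'`-split pairs by `Φ` when `Φ ⋙ G' ≅ G ⋙ Ψ`. -/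
theorem Functor.IsSplitPair.map_of_iso (e : Φ ⋙ G' ≅ G ⋙ Ψ) {X Y : D} (f g : X ⟶ Y)
    [G.IsSplitPair f g] : G'.IsSplitPair (Φ.map f) (Φ.map g) where
  splittable :=
    ⟨_, _, ⟨((HasSplitCoequalizer.isSplitCoequalizer (G.map f) (G.map g)).map Ψ).ofIso
      (e.app X) (e.app Y) (e.hom.naturality f) (e.hom.naturality g)⟩⟩

/-- In a square `Φ ⋙ G' ≅ G ⋙ Ψ` with `Φ` and `Ψ` fully faithful, `G'` monadic and the essential
image of `Φ` being the preimage of that of `Ψ`, the right adjoint `G` is monadic. -/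
theorem nonempty_monadicRightAdjoint_of_fullyFaithful_square [MonadicRightAdjoint G']
    [Φ.Full] [Φ.Faithful] [Ψ.Full] [Ψ.Faithful] (e : Φ ⋙ G' ≅ G ⋙ Ψ) {F : C ⥤ D} (adj : F ⊣ G)
    (h : ∀ d : D', Ψ.essImage (G'.obj d) → Φ.essImage d) :
    Nonempty (MonadicRightAdjoint G) := by
  have key {X Y : D} (f g : X ⟶ Y) [G.IsSplitPair f g] :
      HasCoequalizer f g ∧ PreservesColimit (parallelPair f g) G := by
    let K := parallelPair f g
    have := Functor.IsSplitPair.map_of_iso e f g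
    let := Monad.createsGSplitCoequalizersOfMonadic (G := G') (Φ.map f) (Φ.map g)
    have hs : HasColimit (parallelPair (Φ.map f) (Φ.map g) ⋙ G') := by
      rw [hasColimit_iff_of_iso (diagramIsoParallelPair _)]
      exact inferInstanceAs <| HasCoequalizer (G'.map (Φ.map f)) (G'.map (Φ.map g))
    have hc : HasColimit (parallelPair (Φ.map f) (Φ.map g)) := hasColimit_of_created _ G'
    have i : K ⋙ Φ ≅ parallelPair (Φ.map f) (Φ.map g) := diagramIsoParallelPair _
    have : HasColimit (K ⋙ Φ) := by rwa [hasColimit_iff_of_iso i]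
    have : PreservesColimit (K ⋙ Φ) G' := preservesColimit_of_iso_diagram G' i.symm
    have j : K ⋙ G ≅ parallelPair (G.map f) (G.map g) := diagramIsoParallelPair _
    have : HasColimit (K ⋙ G) := by
      rw [hasColimit_iff_of_iso j]
      exact inferInstanceAs <| HasCoequalizer (G.map f) (G.map g)
    have : PreservesColimit (K ⋙ G) Ψ := preservesColimit_of_iso_diagram Ψ j.symm
    -- Both sides are colimits of `K ⋙ Φ ⋙ G' ≅ K ⋙ G ⋙ Ψ`: `G'` preserves the coequalizer by
    -- monadicity, `Ψ` because it is split.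
    have iso : Ψ.obj (colimit (K ⋙ G)) ≅ G'.obj (colimit (K ⋙ Φ)) :=
      (IsColimit.coconePointsIsoOfNatIso
        (isColimitOfPreserves G' (colimit.isColimit (K ⋙ Φ)))
        (isColimitOfPreserves Ψ (colimit.isColimit (K ⋙ G)))
        (Functor.isoWhiskerLeft K e)).symm
    obtain ⟨d, ⟨k⟩⟩ := h _ ⟨_, ⟨iso⟩⟩
    -- The coequalizer upstairs lies in the image of `Φ`, so it descends; `Ψ`, being fully faithful,
    -- reflects its preservation to `G`.
    let : CreatesColimit K Φ := createsColimitOfFullyFaithfulOfIso d k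
    have : PreservesColimit K (G ⋙ Ψ) := preservesColimit_of_natIso K e
    exact ⟨hasColimit_of_created K Φ, preservesColimit_of_reflects_of_preserves G Ψ⟩
  have : Monad.HasCoequalizerOfIsSplitPair G := ⟨fun f g _ => (key f g).1⟩
  have : Monad.PreservesColimitOfIsSplitPair G := ⟨fun f g _ => (key f g).2⟩
  have := reflectsIsomorphisms_of_monadicRightAdjoint G'
  have : (G ⋙ Ψ).ReflectsIsomorphisms := reflectsIsomorphisms_of_iso e
  have : G.ReflectsIsomorphisms := reflectsIsomorphisms_of_comp G Ψ
  exact ⟨Monad.monadicOfHasPreservesGSplitCoequalizersOfReflectsIsomorphisms adj⟩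

end

end CategoryTheory

namespace LaxComma

variable {X : Type u} [Category.{v} X]

/-- An object `(W, a)` of `Cat // X` is initial-valued if every `a w` is an initial object. -/
def IsInitialValued (A : LaxComma.{w} X) : Prop := ∀ x, Nonempty (IsInitial (A.str.obj x))

namespace IsInitialValued

variable {A B : LaxComma.{w} X}

/-- Morphisms out of an initial-valued object are determined by their functor. -/
theorem hom_ext (hA : A.IsInitialValued) {p q : A ⟶ B}
    (h : (forget X).map p = (forget X).map q) : p = q := by
  obtain ⟨f, γ⟩ := p
  obtain ⟨g, δ⟩ := q
  obtain rfl : f = g := congrArg Cat.Hom.toFunctor h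
  exact congrArg (Hom.mk f) (by ext x; exact (hA x).some.hom_ext _ _)

/-- The morphism out of an initial-valued object with a given functor. -/
noncomputable def homMk (hA : A.IsInitialValued) (f : (forget X).obj A ⟶ (forget X).obj B) : A ⟶ B :=
  Hom.mk f.toFunctor
    { app x := (hA x).some.to _
      naturality x _ _ := (hA x).some.hom_ext _ _ }

/-- Initial-valued objects form a sieve when initial objects are strict. -/
theorem of_hom [HasStrictInitialObjects X] (hB : B.IsInitialValued) (p : A ⟶ B) :
    A.IsInitialValued :=
  fun x => ⟨(hB (p.fctr.obj x)).some.ofStrict (p.cell.app x)⟩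

end IsInitialValued

variable [HasInitial X]

/-- The pair `(W, 0)` of a small category `W` and the constant functor at the initial object. -/
noncomputable def free (X : Type u) [Category.{v} X] [HasInitial X] (W : Cat.{w, w}) :
    LaxComma.{w} X where
  base := W
  str := (Functor.const W).obj (⊥_ X)

theorem isInitialValued_free (W : Cat.{w, w}) : (free X W).IsInitialValued :=
  fun _ => ⟨initialIsInitial⟩

/-- The morphism `(W, 0) ⟶ A` with a given functor. -/
noncomputable def freeHom {W : Cat.{w, w}} {A : LaxComma.{w} X} (f : W ⟶ (forget X).obj A) :
    free X W ⟶ A :=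
  (isInitialValued_free W).homMk f

/-- The functor `Cat / Y ⥤ (Cat // X) / (Y, b)` sending `E ⟶ Y` to `(E, 0) ⟶ (Y, b)`. -/
noncomputable def overFree (B : LaxComma.{w} X) : Over ((forget X).obj B) ⥤ Over B where
  obj E := Over.mk (freeHom E.hom)
  map {_ E'} k := Over.homMk (freeHom (A := free X E'.left) k.left)
    ((isInitialValued_free _).hom_ext (Over.w k))
  map_id _ := Over.OverMorphism.ext ((isInitialValued_free _).hom_ext rfl)
  map_comp _ _ := Over.OverMorphism.ext ((isInitialValued_free _).hom_ext rfl)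

instance (B : LaxComma.{w} X) : (overFree B).Faithful where
  map_injective {_ _} _ _ h :=
    Over.OverMorphism.ext (congrArg (fun p => (forget X).map (Over.Hom.left p)) h)

instance (B : LaxComma.{w} X) : (overFree B).Full where
  map_surjective {_ _} p :=
    ⟨Over.homMk ((forget X).map p.left) (congrArg (forget X).map (Over.w p)),
      Over.OverMorphism.ext ((isInitialValued_free _).hom_ext rfl)⟩

/-- The inclusion of `(D, 0)` into `(D, d)`, over `B`. -/
noncomputable def overFreeCounit {B : LaxComma.{w} X} (D : Over B) :
    (overFree B).obj (Over.mk ((forget X).map D.hom)) ⟶ D :=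
  Over.homMk (freeHom (𝟙 ((forget X).obj D.left))) ((isInitialValued_free _).hom_ext rfl)

theorem essImage_overFree_iff [HasStrictInitialObjects X] {B : LaxComma.{w} X} (D : Over B) :
    (overFree B).essImage D ↔ D.left.IsInitialValued := by
  refine ⟨fun ⟨E, ⟨i⟩⟩ => (isInitialValued_free E.left).of_hom i.inv.left, fun h => ?_⟩
  refine ⟨Over.mk ((forget X).map D.hom), ⟨?_⟩⟩
  exact
    { hom := overFreeCounit D
      inv := Over.homMk (h.homMk (B := free X D.left.base) (𝟙 ((forget X).obj D.left))) (h.hom_ext rfl)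
      hom_inv_id := Over.OverMorphism.ext ((isInitialValued_free _).hom_ext rfl)
      inv_hom_id := Over.OverMorphism.ext (h.hom_ext rfl) }

/-- Anything mapping to `(D, 0)` is initial-valued by strictness, so its morphisms are determined by
their functors, and the counit is the identity on functors. -/
instance [HasStrictInitialObjects X] {B : LaxComma.{w} X} (D : Over B) :
    Mono (overFreeCounit D) where
  right_cancellation {Z} g h e := by
    have hZ : Z.left.IsInitialValued := (isInitialValued_free _).of_hom g.left
    exact Over.OverMorphism.ext
      (hZ.hom_ext (congrArg (fun p => (forget X).map p.left) e))

variable [HasStrictInitialObjects X] {A B : LaxComma.{w} X} (q : A ⟶ B)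

/-- Strictness makes the apex of every cone initial-valued, so the universal property reduces to
that of the pullback in `Cat`. -/
theorem isPullback_free (E : Over ((forget X).obj B)) :
    IsPullback (freeHom (pullback.fst E.hom ((forget X).map q)) : free X _ ⟶ free X E.left)
      (freeHom (pullback.snd E.hom ((forget X).map q)) : free X _ ⟶ A) (freeHom E.hom) q where
  w := (isInitialValued_free _).hom_ext (pullback.condition (f := E.hom))
  isLimit' := by
    have hs (s : PullbackCone (freeHom E.hom : free X E.left ⟶ B) q) : s.pt.IsInitialValued :=
      (isInitialValued_free _).of_hom s.fst
    refine ⟨PullbackCone.IsLimit.mk _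
      (fun s => (hs s).homMk (pullback.lift ((forget X).map s.fst) ((forget X).map s.snd)
        (congrArg (forget X).map s.condition)))
      (fun s => (hs s).hom_ext (((forget X).map_comp _ _).trans (pullback.lift_fst _ _ _)))
      (fun s => (hs s).hom_ext (((forget X).map_comp _ _).trans (pullback.lift_snd _ _ _)))
      (fun s m h₁ h₂ => (hs s).hom_ext (pullback.hom_ext ?_ ?_))⟩
    · exact (congrArg (forget X).map h₁).trans (pullback.lift_fst _ _ _).symm
    · exact (congrArg (forget X).map h₂).trans (pullback.lift_snd _ _ _).symm

/-- The embeddings `overFree` are compatible with change of base on objects. -/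
noncomputable def overFreePullbackObjIso [HasPullbacksAlong q] (E : Over ((forget X).obj B)) :
    (overFree A).obj ((Over.pullback ((forget X).map q)).obj E) ≅
      (Over.pullback q).obj ((overFree B).obj E) :=
  Over.isoMk (isPullback_free q E).isoPullback (isPullback_free q E).isoPullback_hom_snd

/-- The embeddings `overFree` are compatible with change of base. -/
noncomputable def overFreePullbackIso [HasPullbacksAlong q] :
    overFree B ⋙ Over.pullback q ≅ Over.pullback ((forget X).map q) ⋙ overFree A :=
  Iso.symm <| NatIso.ofComponents
    (fun E => overFreePullbackObjIso q E)
    (fun {E E'} k => by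
      apply Over.OverMorphism.ext
      apply pullback.hom_ext
      · have h₁ := (isPullback_free q E).isoPullback_hom_fst
        have h₂ := (isPullback_free q E').isoPullback_hom_fst
        have h₃ : ((Over.pullback q).map ((overFree B).map k)).left ≫
            pullback.fst ((overFree B).obj E').hom q =
            pullback.fst ((overFree B).obj E).hom q ≫ ((overFree B).map k).left :=
          pullback.lift_fst _ _ _
        refine ((Category.assoc _ _ _).trans (congrArg (_ ≫ ·) h₂)).trans (Eq.trans ?_
          ((Category.assoc _ _ _).trans (congrArg (_ ≫ ·) h₃)).symm)
        refine Eq.trans ?_ ((Category.assoc _ _ _).symm.trans (congrArg (· ≫ _) h₁)).symm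
        exact (isInitialValued_free _).hom_ext
          (((forget X).map_comp _ _).trans (pullback.lift_fst _ _ _))
      · exact (Over.w ((overFree A).map ((Over.pullback ((forget X).map q)).map k) ≫
          (overFreePullbackObjIso q E').hom)).trans
          (Over.w ((overFreePullbackObjIso q E).hom ≫
            (Over.pullback q).map ((overFree B).map k))).symm)

/-- If `q^* D` is initial-valued, the counit of `q_! ⊣ q^*` at `D` factors through the mono `m : (D,
0) ⟶ D`. So `q^* m` is a split epi and a mono, and `m` is invertible because `q^*` reflects
isomorphisms. -/
theorem essImage_of_essImage_pullback [HasPullbacksAlong q]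
    [(Over.pullback q).ReflectsIsomorphisms] (D : Over B)
    (h : (overFree A).essImage ((Over.pullback q).obj D)) : (overFree B).essImage D := by
  let P := (Over.pullback q).obj D
  have hP : P.left.IsInitialValued := (essImage_overFree_iff _).1 h
  let adj := Over.mapPullbackAdj q
  let m := overFreeCounit D
  let D₀ := (overFree B).obj (Over.mk ((forget X).map D.hom))
  let l : (Over.map q).obj P ⟶ D₀ :=
    Over.homMk (hP.homMk (B := free X ((forget X).obj D.left)) ((forget X).map (adj.counit.app D).left :))
      (hP.hom_ext (congrArg (forget X).map (Over.w (adj.counit.app D)) :))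
  have hl : l ≫ m = adj.counit.app D := Over.OverMorphism.ext (hP.hom_ext rfl)
  have : (Over.pullback q).IsRightAdjoint := adj.isRightAdjoint
  have : IsSplitEpi ((Over.pullback q).map m) :=
    -- The section is the transpose of `l`: followed by `q^* m` it is the transpose of the counit,
    -- an identity.
    ⟨⟨adj.homEquiv _ _ l, by rw [← adj.homEquiv_naturality_right, hl]; exact adj.right_triangle_components D⟩⟩
  have : IsIso ((Over.pullback q).map m) := isIso_of_mono_of_isSplitEpi _
  have : IsIso m := isIso_of_reflects_iso m (Over.pullback q)
  exact ⟨_, ⟨asIso m⟩⟩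

end LaxComma

theorem mainTheorem2 {X : Type u} [Category.{v} X] [HasPullbacks X] [HasInitial X]
    [HasStrictInitialObjects X] {A B : LaxComma.{w} X} (q : A ⟶ B)
    (hq : IsEffectiveDescent q) : IsEffectiveDescent ((LaxComma.forget X).map q) := by
  obtain ⟨_, ⟨_⟩⟩ := hq
  have := CategoryTheory.reflectsIsomorphisms_of_monadicRightAdjoint (Over.pullback q)
  exact ⟨inferInstance, nonempty_monadicRightAdjoint_of_fullyFaithful_square
    (LaxComma.overFreePullbackIso q) (Over.mapPullbackAdj _)
    (LaxComma.essImage_of_essImage_pullback q)⟩
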